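/- Let $a,b,c\ge 0$ be integers. The trinacria graph $T_{abc}$ is the graph on $a+b+c+3$ vertices obtained from a triangle by attaching paths $P_a$, $P_b$, $P_c$ with $a$, $b$, $c$ vertices to its three vertices, respectively (an end of each nonempty path is joined by an edge to the corresponding triangle vertex). For a finite graph $G=(V,E)$ let $$X_G=\sum_{\kappa}\prod_{v\in V}x_{\kappa(v)}$$ be its chromatic symmetric function, a formal power series over $\mathbb Q$ in the variables $x_1,x_2,\dots$, where $\kappa\colon V\to\{1,2,\dots\}$ runs over the proper colorings of $G$. A symmetric function is called $e$-positive if all coefficients of its expansion in the basis of elementary symmetric functions $e_\lambda=e_{\lambda_1}e_{\lambda_2}\cdots$ ($\lambda$ a partition), $e_k=\sum_{i_1<\dots<i_k}x_{i_1}\cdots x_{i_k}$, are nonnegative. Theorem. For every integer $b\ge 0$, the trinacria graph $T_{(b+2)b2}$ is $e$-positive; that is, $X_{T_{(b+2)b2}}$ is $e$-positive. -/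

import Mathlib

open scoped Classical in
/-- The elementary symmetric function `e_k` in countably many variables, as a formal power series:
the coefficient of the monomial `x ^ d` is `1` if that monomial is squarefree of degree `k`, and `0`
otherwise. (The variables are indexed by `ℕ`.) -/
noncomputable def elemSymm (k : ℕ) : MvPowerSeries ℕ ℚ :=
  fun d => if (∀ i, d i ≤ 1) ∧ d.degree = k then 1 else 0

/-- The elementary symmetric function `e_μ = e_{μ₁} e_{μ₂} ⋯` of a partition `μ` of `n`. -/
noncomputable def elemSymmPart {n : ℕ} (μ : n.Partition) : MvPowerSeries ℕ ℚ :=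
  (μ.parts.map elemSymm).prod

/-- The power series `f` is a linear combination, with nonnegative coefficients, of the functions
`e_μ`, where `μ` runs over the partitions of all natural numbers. As these form a basis of the space
of symmetric functions, this says that `f` is a symmetric function and that each of its
`e_μ`-coefficients is nonnegative. -/
def IsEPositive (f : MvPowerSeries ℕ ℚ) : Prop :=
  ∃ c : (Σ n : ℕ, n.Partition) →₀ ℚ,
    (∀ μ, 0 ≤ c μ) ∧ f = c.sum fun μ a => a • elemSymmPart μ.2

namespace SimpleGraph

/-- The exponent vector of the monomial `∏ v, x_{κ v}` of a colouring `κ`. -/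
noncomputable def colorContent {V : Type*} [Fintype V] (κ : V → ℕ) : ℕ →₀ ℕ :=
  ∑ v, Finsupp.single (κ v) 1

/-- The chromatic symmetric function `X_G = ∑ κ, ∏ v, x_{κ v}` of a finite graph, where `κ` runs over
the proper colourings of `G` with colours in `ℕ`: the coefficient of `x ^ d` is the number of those
`κ` (they are finitely many) whose monomial is `x ^ d`. -/
noncomputable def chromaticSymm {V : Type*} [Fintype V] (G : SimpleGraph V) : MvPowerSeries ℕ ℚ :=
  fun d => (Nat.card {κ : G.Coloring ℕ // colorContent κ = d} : ℚ)

/-- The number of colourings counted in `SimpleGraph.chromaticSymm` is finite. -/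
theorem finite_coloring_colorContent {V : Type*} [Fintype V] (G : SimpleGraph V) (d : ℕ →₀ ℕ) :
    Finite {κ : G.Coloring ℕ // colorContent κ = d} := by
  have key : ∀ κ : {κ : G.Coloring ℕ // colorContent κ = d}, ∀ v, κ.1 v ∈ d.support := by
    rintro ⟨κ, rfl⟩ v
    simp only [Finsupp.mem_support_iff, colorContent, Finsupp.finsetSum_apply]
    intro h
    have := (Finset.sum_eq_zero_iff.mp h) v (Finset.mem_univ v)
    simp at this
  refine Finite.of_injective
    (fun κ => fun v => (⟨κ.1 v, key κ v⟩ : d.support)) ?_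
  intro κ κ' h
  apply Subtype.ext
  apply DFunLike.ext
  intro v
  exact congrArg Subtype.val (congrFun h v)

/-- The trinacria graph `T_{abc}`: a triangle to whose three vertices paths on `a`, `b` and `c`
vertices are attached. The vertices are the pairs `⟨i, j⟩` with `i` one of the three arms and `j` at
most the length of the arm; `⟨i, 0⟩` is the vertex of the triangle on the `i`-th arm, and
`⟨i, 1⟩, ⟨i, 2⟩, …` are the vertices of the path attached to it, in order. -/
def trinacria (a b c : ℕ) : SimpleGraph (Σ i : Fin 3, Fin (![a, b, c] i + 1)) where
  Adj u v :=
    (u.1 = v.1 ∧ ((u.2 : ℕ) + 1 = v.2 ∨ (v.2 : ℕ) + 1 = u.2)) ∨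
      (u.1 ≠ v.1 ∧ (u.2 : ℕ) = 0 ∧ (v.2 : ℕ) = 0)
  symm := ⟨fun u v h => by
    rcases h with ⟨h, h'⟩ | ⟨h, h', h''⟩
    · exact Or.inl ⟨h.symm, h'.symm⟩
    · exact Or.inr ⟨h.symm, h'', h'⟩⟩
  loopless := ⟨fun u h => by
    rcases h with ⟨_, h⟩ | ⟨h, _⟩
    · omega
    · exact h rfl⟩

end SimpleGraph

/-! In finitely many variables, let p_m(c) be the generating function of the proper colourings of
the path on m + 1 vertices whose first vertex has colour c, and let P_m = ∑ p_m(c).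
Inclusion–exclusion on the triangle and the rule x_c p_m(c) = x_c P_m - p_{m+1}(c) turn X into a
quadratic polynomial in the P_m (`trinacriaSum_add_two`).

With E(z) = ∑ e_k z^k one has ∑ P_m z^m = E' / (E - zE'), and E - zE' = 1 - ∑_{i ≥ 2} (i - 1) e_i
z^i. So P_m is expressed by sums over words with entries at least 2, and e_1 appears only as an
explicit factor (`pathSum_eq`). This gives X = A + e_1 B + e_1² C (`trinacriaSum_expansion`).

A product of two word sums is a sum over longer words with a break at a fixed position
(`wordSum_break`). Hence each of A, B, C is a single sum of φ(K) w(K), with φ determined by a few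
breaks near the middle and the ends and by the first and last entries. This φ can be negative. But
reversing the part of a word on one side of a break preserves the weight, so certain differences of
double breaks sum to zero (`wordSum_reversalTerm`). Adding suitable rational multiples of them makes
φ nonnegative on every word. That is a finite check, since breaks are never at distance one. -/

open Finset

/-! ### Words and their breaks -/

/-- The words of `n`: the lists of integers at least two whose sum is `n`. -/
def blockWords (n : ℕ) : Finset (List ℕ) :=
  ((univ : Finset (Composition n)).image Composition.blocks).filter fun K => ∀ i ∈ K, 2 ≤ i

theorem mem_blockWords {n : ℕ} {K : List ℕ} :
    K ∈ blockWords n ↔ (∀ i ∈ K, 2 ≤ i) ∧ K.sum = n := by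
  simp only [blockWords, mem_filter, mem_image, mem_univ, true_and]
  constructor
  · rintro ⟨⟨c, rfl⟩, h⟩
    exact ⟨h, c.blocks_sum⟩
  · rintro ⟨h, hs⟩
    exact ⟨⟨⟨K, fun {i} hi => by have := h i hi; omega, hs⟩, rfl⟩, h⟩

theorem blockWords_zero : blockWords 0 = {[]} := by
  ext K
  rw [mem_blockWords, mem_singleton]
  constructor
  · rintro ⟨h, hs⟩
    cases K with
    | nil => rfl
    | cons i K =>
      have := h i (by simp)
      simp at hs
      omega
  · rintro rfl
    simp

theorem blockWords_one : blockWords 1 = ∅ := by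
  ext K
  rw [mem_blockWords]
  simp only [notMem_empty, iff_false]
  rintro ⟨h, hs⟩
  cases K with
  | nil => simp at hs
  | cons i K =>
    have := h i (by simp)
    simp at hs
    omega

theorem reverse_mem_blockWords {n : ℕ} {K : List ℕ} (h : K ∈ blockWords n) :
    K.reverse ∈ blockWords n := by
  rw [mem_blockWords] at h ⊢
  simpa using h

theorem append_mem_blockWords {k l : ℕ} {I J : List ℕ} (hI : I ∈ blockWords k)
    (hJ : J ∈ blockWords l) : I ++ J ∈ blockWords (k + l) := by
  rw [mem_blockWords] at hI hJ ⊢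
  refine ⟨fun i hi => ?_, by rw [List.sum_append, hI.2, hJ.2]⟩
  rcases List.mem_append.1 hi with h | h
  exacts [hI.1 i h, hJ.1 i h]

/-- `K` has a prefix with sum `k`. -/
def IsBreak (k : ℕ) (K : List ℕ) : Prop := ∃ I J, K = I ++ J ∧ I.sum = k

open scoped Classical in
/-- The indicator function of the words that have a prefix with sum `k`. -/
noncomputable def breakInd (k : ℕ) (K : List ℕ) : ℚ := if IsBreak k K then 1 else 0

theorem breakInd_eq_zero_or_one (k : ℕ) (K : List ℕ) : breakInd k K = 0 ∨ breakInd k K = 1 := by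
  unfold breakInd
  split_ifs <;> simp

theorem isBreak_iff_of_append {k : ℕ} {I J : List ℕ} (h : I.sum ≤ k) :
    IsBreak k (I ++ J) ↔ IsBreak (k - I.sum) J := by
  constructor
  · rintro ⟨A, B, hAB, hA⟩
    rcases List.append_eq_append_iff.1 hAB with ⟨C, hC, hC'⟩ | ⟨C, hC, hC'⟩
    · refine ⟨C, B, hC', ?_⟩
      rw [hC, List.sum_append] at hA
      omega
    · have h1 : C.sum = 0 := by
        rw [hC, List.sum_append] at h
        omega
      refine ⟨[], J, rfl, ?_⟩
      rw [hC, List.sum_append]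
      simp
      omega
  · rintro ⟨A, B, hAB, hA⟩
    exact ⟨I ++ A, B, by rw [hAB, List.append_assoc], by rw [List.sum_append]; omega⟩

theorem isBreak_reverse {k l : ℕ} {K : List ℕ} (h : K.sum = k + l) :
    IsBreak k K.reverse ↔ IsBreak l K := by
  constructor
  · rintro ⟨I, J, hK, hI⟩
    rw [List.reverse_eq_append_iff] at hK
    refine ⟨J.reverse, I.reverse, hK, ?_⟩
    rw [hK, List.sum_append, List.sum_reverse, List.sum_reverse] at h
    rw [List.sum_reverse]
    omega
  · rintro ⟨I, J, hK, hI⟩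
    refine ⟨J.reverse, I.reverse, by rw [hK, List.reverse_append], ?_⟩
    rw [hK, List.sum_append] at h
    rw [List.sum_reverse]
    omega

/-- Two breaks at distance one would enclose an entry equal to 1. This exclusion prunes the case
checks in the local inequalities. -/
theorem not_isBreak_of_isBreak {k : ℕ} {K : List ℕ} (hK : ∀ i ∈ K, 2 ≤ i) (h : IsBreak k K) :
    ¬ IsBreak (k + 1) K := by
  obtain ⟨I, J, rfl, rfl⟩ := h
  rw [isBreak_iff_of_append (by omega)]
  rintro ⟨A, B, rfl, hA⟩
  cases A with
  | nil => simp at hA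
  | cons i A =>
    have := hK i (by simp)
    simp at hA
    omega

theorem breakInd_mul_succ {k : ℕ} {K : List ℕ} (hK : ∀ i ∈ K, 2 ≤ i) :
    breakInd k K = 0 ∨ breakInd (k + 1) K = 0 := by
  by_cases h : IsBreak k K
  · right
    simp [breakInd, not_isBreak_of_isBreak hK h]
  · left
    simp [breakInd, h]

/-- `i / (i - 1)` for the first entry `i` of a word. -/
def headFactor (K : List ℕ) : ℚ := (K.headI : ℚ) / (K.headI - 1)

/-- `i / (i - 1)` for the last entry `i` of a word. -/
def lastFactor (K : List ℕ) : ℚ := headFactor K.reverse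

theorem isBreak_cons_self {i : ℕ} {K : List ℕ} : IsBreak i (i :: K) := ⟨[i], K, rfl, by simp⟩

/-- As i / (i - 1) decreases, only the entries 2 and 3 need exact values, and they are detected by
breaks at 2 and 3. From 4 on, the bounds 1 and 4/3 suffice. -/
theorem headFactor_cases {n : ℕ} (hn : 0 < n) {K : List ℕ} (hK : K ∈ blockWords n) :
    (breakInd 2 K = 1 ∧ breakInd 3 K = 0 ∧ headFactor K = 2) ∨
    (breakInd 2 K = 0 ∧ breakInd 3 K = 1 ∧ headFactor K = 3 / 2) ∨
    (breakInd 2 K = 0 ∧ breakInd 3 K = 0 ∧ 1 ≤ headFactor K ∧ headFactor K ≤ 4 / 3) := by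
  obtain ⟨h2, hs⟩ := mem_blockWords.1 hK
  cases K with
  | nil => simp at hs; omega
  | cons i K =>
    have hi := h2 i (by simp)
    have key : ∀ k, 0 < k → k < i → ¬ IsBreak k (i :: K) := by
      rintro k hk hki ⟨A, B, hAB, hA⟩
      cases A with
      | nil => simp at hA; omega
      | cons j A =>
        simp only [List.cons_append, List.cons.injEq] at hAB
        simp at hA
        omega
    rcases eq_or_ne i 2 with rfl | hi2
    · left
      have h3 := not_isBreak_of_isBreak h2 (isBreak_cons_self (i := 2) (K := K))
      simp only [Nat.reduceAdd] at h3
      simp [breakInd, isBreak_cons_self, h3, headFactor]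
      norm_num
    rcases eq_or_ne i 3 with rfl | hi3
    · right; left
      simp [breakInd, isBreak_cons_self, key 2, headFactor]
      norm_num
    right; right
    refine ⟨by simp [breakInd, key 2 (by omega) (by omega)],
      by simp [breakInd, key 3 (by omega) (by omega)], ?_⟩
    have h4 : (4 : ℚ) ≤ i := by exact_mod_cast (by omega : 4 ≤ i)
    simp only [headFactor, List.headI_cons]
    rw [le_div_iff₀ (by linarith), div_le_iff₀ (by linarith)]
    constructor <;> linarith

theorem breakInd_reverse {k l : ℕ} {K : List ℕ} (h : K ∈ blockWords (k + l)) :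
    breakInd k K.reverse = breakInd l K := by
  have := isBreak_reverse (mem_blockWords.1 h).2
  by_cases hl : IsBreak l K <;> simp [breakInd, this, hl]

/-! ### Weighted sums over words -/

section WordSum

variable {R : Type*} [CommRing R] [Algebra ℚ R] (e : ℕ → R)

/-- The product of `(i - 1) e_i` over the entries `i` of a word. -/
def wordWeight (K : List ℕ) : R := (K.map fun i : ℕ => ((i : ℚ) - 1) • e i).prod

/-- The sum of `φ K` times the weight of `K` over the words `K` of `n`. -/
def wordSum (n : ℕ) (φ : List ℕ → ℚ) : R := ∑ K ∈ blockWords n, φ K • wordWeight e K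

theorem wordWeight_append (I J : List ℕ) :
    wordWeight e (I ++ J) = wordWeight e I * wordWeight e J := by
  simp [wordWeight]

theorem wordWeight_reverse (K : List ℕ) : wordWeight e K.reverse = wordWeight e K := by
  simp [wordWeight, List.map_reverse, List.prod_reverse]

theorem wordSum_congr {n : ℕ} {φ ψ : List ℕ → ℚ} (h : ∀ K ∈ blockWords n, φ K = ψ K) :
    wordSum e n φ = wordSum e n ψ :=
  sum_congr rfl fun K hK => by rw [h K hK]

theorem wordSum_add (n : ℕ) (φ ψ : List ℕ → ℚ) :
    wordSum e n (fun K => φ K + ψ K) = wordSum e n φ + wordSum e n ψ := by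
  simp [wordSum, add_smul, sum_add_distrib]

theorem wordSum_sub (n : ℕ) (φ ψ : List ℕ → ℚ) :
    wordSum e n (fun K => φ K - ψ K) = wordSum e n φ - wordSum e n ψ := by
  simp [wordSum, sub_smul, sum_sub_distrib]

theorem wordSum_mul (n : ℕ) (a : ℚ) (φ : List ℕ → ℚ) :
    wordSum e n (fun K => a * φ K) = a • wordSum e n φ := by
  simp [wordSum, mul_smul, smul_sum]

theorem wordSum_reverse (n : ℕ) (φ : List ℕ → ℚ) :
    wordSum e n (fun K => φ K.reverse) = wordSum e n φ := by
  refine sum_nbij' List.reverse List.reverse (fun K => reverse_mem_blockWords)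
    (fun K => reverse_mem_blockWords) (by simp) (by simp) fun K _ => ?_
  rw [wordWeight_reverse]

/-- Cutting at the break is a bijection onto pairs of words, and the weight is multiplicative under
concatenation. -/
theorem wordSum_break (k l : ℕ) {φ α β : List ℕ → ℚ}
    (h : ∀ I ∈ blockWords k, ∀ J ∈ blockWords l, φ (I ++ J) = α I * β J) :
    wordSum e (k + l) (fun K => breakInd k K * φ K) = wordSum e k α * wordSum e l β := by
  classical
  rw [wordSum, wordSum, wordSum, sum_mul_sum, ← sum_product']
  have : ∑ K ∈ blockWords (k + l), (breakInd k K * φ K) • wordWeight e K =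
      ∑ K ∈ (blockWords (k + l)).filter (IsBreak k), φ K • wordWeight e K := by
    rw [sum_filter]
    refine sum_congr rfl fun K _ => ?_
    unfold breakInd
    split_ifs <;> simp
  rw [this]
  symm
  refine sum_bij (fun p _ => p.1 ++ p.2) ?_ ?_ ?_ ?_
  · rintro ⟨I, J⟩ hIJ
    rw [mem_product] at hIJ
    exact mem_filter.2 ⟨append_mem_blockWords hIJ.1 hIJ.2, I, J, rfl, (mem_blockWords.1 hIJ.1).2⟩
  · rintro ⟨I, J⟩ hIJ ⟨I', J'⟩ hIJ' heq
    simp only [mem_product, mem_blockWords] at hIJ hIJ' heq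
    -- Entries are positive, so two cuts at the same partial sum differ by an empty list `C`.
    have nil_of : ∀ C : List ℕ, (∀ i ∈ C, 2 ≤ i) → C.sum = 0 → C = [] := by
      intro C h0 h1
      have : C ∈ blockWords 0 := mem_blockWords.2 ⟨h0, h1⟩
      simpa [blockWords_zero] using this
    rcases List.append_eq_append_iff.1 heq with ⟨C, hC, hC'⟩ | ⟨C, hC, hC'⟩
    · have : C = [] := nil_of C
        (fun i hi => hIJ'.1.1 i (by rw [hC]; exact List.mem_append_right _ hi)) (by
          have h1 := hIJ'.1.2
          rw [hC, List.sum_append, hIJ.1.2] at h1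
          omega)
      subst this
      simp_all
    · have : C = [] := nil_of C
        (fun i hi => hIJ.1.1 i (by rw [hC]; exact List.mem_append_right _ hi)) (by
          have h1 := hIJ.1.2
          rw [hC, List.sum_append, hIJ'.1.2] at h1
          omega)
      subst this
      simp_all
  · intro K hK
    obtain ⟨hK, I, J, rfl, hI⟩ := mem_filter.1 hK
    obtain ⟨h2, hs⟩ := mem_blockWords.1 hK
    refine ⟨(I, J), mem_product.2 ⟨mem_blockWords.2 ⟨fun i hi => h2 i (by simp [hi]), hI⟩,
      mem_blockWords.2 ⟨fun i hi => h2 i (by simp [hi]), ?_⟩⟩, rfl⟩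
    rw [List.sum_append] at hs
    show J.sum = l
    omega
  · rintro ⟨I, J⟩ hIJ
    rw [mem_product] at hIJ
    rw [h I hIJ.1 J hIJ.2, wordWeight_append, smul_mul_smul_comm]

theorem wordSum_cons {n : ℕ} (hn : 0 < n) (φ : List ℕ → ℚ) :
    wordSum e n φ =
      ∑ i ∈ Icc 2 n, ((i : ℚ) - 1) • (e i * wordSum e (n - i) fun K => φ (i :: K)) := by
  simp only [wordSum, mul_sum, smul_sum]
  rw [sum_sigma']
  symm
  refine sum_bij (fun p _ => p.1 :: p.2) ?_ ?_ ?_ ?_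
  · rintro ⟨i, K⟩ h
    simp only [mem_sigma, mem_Icc, mem_blockWords] at h
    rw [mem_blockWords]
    refine ⟨fun j hj => ?_, by simp; omega⟩
    rcases List.mem_cons.1 hj with rfl | hj
    exacts [h.1.1, h.2.1 j hj]
  · rintro ⟨i, K⟩ _ ⟨j, K'⟩ _ heq
    simp only [List.cons.injEq] at heq
    obtain ⟨rfl, rfl⟩ := heq
    rfl
  · intro K hK
    rw [mem_blockWords] at hK
    cases K with
    | nil => simp at hK; omega
    | cons i K =>
      have hs := hK.2
      simp only [List.sum_cons] at hs
      refine ⟨⟨i, K⟩, ?_, rfl⟩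
      simp only [mem_sigma, mem_Icc, mem_blockWords]
      exact ⟨⟨hK.1 i (by simp), by omega⟩, fun j hj => hK.1 j (by simp [hj]), by omega⟩
  · rintro ⟨i, K⟩ _
    simp only [wordWeight, List.map_cons, List.prod_cons, mul_smul_comm, smul_mul_assoc, smul_smul,
      mul_comm (φ _)]

/-- The sum of the weights of the words of `n`. -/
def weightSum (n : ℕ) : R := wordSum e n fun _ => 1

/-- The sum of the weights of the words of `n`, where the first entry `i` counts `i` instead of
`i - 1`. -/
def headSum (n : ℕ) : R := wordSum e n headFactor

theorem weightSum_zero : weightSum e 0 = 1 := by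
  simp [weightSum, wordSum, blockWords_zero, wordWeight]

theorem weightSum_one : weightSum e 1 = 0 := by
  simp [weightSum, wordSum, blockWords_one]

theorem headSum_one : headSum e 1 = 0 := by
  simp [headSum, wordSum, blockWords_one]

theorem weightSum_eq {n : ℕ} (hn : 0 < n) :
    weightSum e n = ∑ i ∈ Icc 2 n, ((i : ℚ) - 1) • (e i * weightSum e (n - i)) :=
  wordSum_cons e hn _

theorem headSum_eq {n : ℕ} (hn : 0 < n) :
    headSum e n = ∑ i ∈ Icc 2 n, (i : ℚ) • (e i * weightSum e (n - i)) := by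
  rw [headSum, wordSum_cons e hn]
  refine sum_congr rfl fun i hi => ?_
  have h2 : (2 : ℚ) ≤ i := by exact_mod_cast (mem_Icc.1 hi).1
  have : (wordSum e (n - i) fun K => headFactor (i :: K)) =
      ((i : ℚ) / (i - 1)) • weightSum e (n - i) := by
    rw [weightSum, ← wordSum_mul]
    exact wordSum_congr e fun K _ => by simp [headFactor]
  rw [this, mul_smul_comm, smul_smul, mul_div_cancel₀ _ (by linarith : (i : ℚ) - 1 ≠ 0)]

theorem weightSum_two : weightSum e 2 = e 2 := by
  rw [weightSum_eq e two_pos]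
  norm_num [weightSum_zero]

theorem weightSum_three : weightSum e 3 = 2 * e 3 := by
  rw [weightSum_eq e three_pos, show Icc 2 3 = {2, 3} from rfl, sum_pair (by norm_num)]
  norm_num [weightSum_zero, weightSum_one, ofNat_smul_eq_nsmul]

theorem headSum_two : headSum e 2 = 2 * e 2 := by
  rw [headSum_eq e two_pos]
  norm_num [weightSum_zero, ofNat_smul_eq_nsmul]

theorem headSum_three : headSum e 3 = 3 * e 3 := by
  rw [headSum_eq e three_pos, show Icc 2 3 = {2, 3} from rfl, sum_pair (by norm_num)]
  norm_num [weightSum_zero, weightSum_one, ofNat_smul_eq_nsmul]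

theorem wordSum_lastFactor (n : ℕ) : wordSum e n lastFactor = headSum e n :=
  wordSum_reverse e n headFactor

theorem ne_nil_of_mem_blockWords {k : ℕ} (hk : 0 < k) {K : List ℕ} (hK : K ∈ blockWords k) :
    K ≠ [] := by
  rintro rfl
  have := (mem_blockWords.1 hK).2
  simp at this
  omega

theorem headFactor_append {I : List ℕ} (hI : I ≠ []) (J : List ℕ) :
    headFactor (I ++ J) = headFactor I := by
  cases I with
  | nil => exact absurd rfl hI
  | cons i I => rfl

theorem lastFactor_append (I : List ℕ) {J : List ℕ} (hJ : J ≠ []) :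
    lastFactor (I ++ J) = lastFactor J := by
  rw [lastFactor, List.reverse_append, headFactor_append (by simpa using hJ), lastFactor]

theorem wordSum_breakInd {n k l : ℕ} (hn : n = k + l) :
    wordSum e n (fun K => breakInd k K) = weightSum e k * weightSum e l := by
  subst hn
  rw [weightSum, weightSum, ← wordSum_break e k l (φ := fun _ => 1) (by simp)]
  simp

theorem wordSum_breakInd_mul_headFactor {n k l : ℕ} (hn : n = k + l) (hk : 0 < k) :
    wordSum e n (fun K => breakInd k K * headFactor K) = weightSum e l * headSum e k := by
  subst hn
  rw [mul_comm]
  refine wordSum_break e k l fun I hI J _ => ?_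
  rw [headFactor_append (ne_nil_of_mem_blockWords hk hI), mul_one]

theorem wordSum_breakInd_mul_lastFactor {n k l : ℕ} (hn : n = k + l) (hl : 0 < l) :
    wordSum e n (fun K => breakInd k K * lastFactor K) = weightSum e k * headSum e l := by
  subst hn
  rw [← wordSum_lastFactor]
  refine wordSum_break e k l fun I _ J hJ => ?_
  rw [lastFactor_append _ (ne_nil_of_mem_blockWords hl hJ), one_mul]

/-- The second factor is read backwards: its distinguished first entry becomes the last entry of the
concatenation. -/
theorem wordSum_breakInd_mul_headFactor_mul_lastFactor {n k l : ℕ} (hn : n = k + l) (hk : 0 < k)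
    (hl : 0 < l) :
    wordSum e n (fun K => breakInd k K * (headFactor K * lastFactor K)) =
      headSum e k * headSum e l := by
  subst hn
  rw [← wordSum_lastFactor e l]
  refine wordSum_break e k l fun I hI J hJ => ?_
  rw [headFactor_append (ne_nil_of_mem_blockWords hk hI),
    lastFactor_append _ (ne_nil_of_mem_blockWords hl hJ)]

/-- After a cut at `k`, the break at `k + l` is a break at `l` of the right part, which is cut once
more. -/
theorem wordSum_breakInd_mul_breakInd {n k l m r : ℕ} (hn : n = k + l + m) (hr : r = k + l) :
    wordSum e n (fun K => breakInd k K * breakInd r K) =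
      weightSum e k * (weightSum e l * weightSum e m) := by
  subst hn hr
  rw [add_assoc, ← wordSum_breakInd e rfl]
  refine wordSum_break e k (l + m) fun I hI J _ => ?_
  have := isBreak_iff_of_append (k := k + l) (I := I) (J := J)
    (by rw [(mem_blockWords.1 hI).2]; omega)
  rw [(mem_blockWords.1 hI).2, Nat.add_sub_cancel_left] at this
  by_cases h : IsBreak l J <;> simp [breakInd, this, h]

end WordSum

theorem lastFactor_cases {n k l : ℕ} (hk : n = k + 2) (hl : n = l + 3) {K : List ℕ}
    (hK : K ∈ blockWords n) :
    (breakInd k K = 1 ∧ breakInd l K = 0 ∧ lastFactor K = 2) ∨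
    (breakInd k K = 0 ∧ breakInd l K = 1 ∧ lastFactor K = 3 / 2) ∨
    (breakInd k K = 0 ∧ breakInd l K = 0 ∧ 1 ≤ lastFactor K ∧ lastFactor K ≤ 4 / 3) := by
  have h := headFactor_cases (by omega) (reverse_mem_blockWords hK)
  rwa [breakInd_reverse (k := 2) (l := k) (by rwa [add_comm, ← hk]),
    breakInd_reverse (k := 3) (l := l) (by rwa [add_comm, ← hl])] at h

/-- For `n = k + l + j`, `r = k + j`, `s = k + l`, `t = l + j`: the number of ways to obtain an
entry `j` next to a break at `k` or `t`, minus the same number after reversing the part of the word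
on that side of the break. -/
noncomputable def reversalTerm (j k l r s t : ℕ) (K : List ℕ) : ℚ :=
  breakInd k K * (breakInd r K - breakInd s K) + breakInd t K * (breakInd l K - breakInd j K)

/-- Each double break sums to a product of three `weightSum`s, of `j`, `k` and `l` in some order, so
the differences cancel by commutativity. -/
theorem wordSum_reversalTerm {R : Type*} [CommRing R] [Algebra ℚ R] (e : ℕ → R)
    {n j k l r s t : ℕ} (hn : n = k + l + j) (hr : r = k + j) (hs : s = k + l) (ht : t = l + j) :
    wordSum e n (reversalTerm j k l r s t) = 0 := by
  have h1 := wordSum_breakInd_mul_breakInd e (n := n) (k := k) (l := j) (m := l) (r := r)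
    (by omega) hr
  have h2 := wordSum_breakInd_mul_breakInd e (n := n) (k := k) (l := l) (m := j) (r := s)
    (by omega) hs
  have h3 := wordSum_breakInd_mul_breakInd e (n := n) (k := l) (l := j) (m := k) (r := t)
    (by omega) ht
  have h4 := wordSum_breakInd_mul_breakInd e (n := n) (k := j) (l := l) (m := k) (r := t)
    (by omega) (by omega)
  have : reversalTerm j k l r s t = fun K =>
      breakInd k K * breakInd r K - breakInd k K * breakInd s K +
        (breakInd l K * breakInd t K - breakInd j K * breakInd t K) := by
    funext K
    unfold reversalTerm
    ring
  rw [this, wordSum_add, wordSum_sub, wordSum_sub, h1, h2, h3, h4]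
  ring

/-! ### Pointwise inequalities for a single word -/

section LocalInequalities

variable {x₀ x₁ x₂ x₃ x₄ x₅ x₆ c₂ c₃ d₂ d₃ F L : ℚ}

/-- The `x` are the break indicators at successive positions around the middle; `c₂` and `d₂` are
those at distance 2 from the left and right ends. Apart from the exclusion of adjacent middle breaks
they are treated as independent, so small `b`, where positions coincide, needs no separate case. -/
theorem two_ones_local (h₁ : x₁ = 0 ∨ x₁ = 1) (h₂ : x₂ = 0 ∨ x₂ = 1) (h₃ : x₃ = 0 ∨ x₃ = 1)
    (h₄ : x₄ = 0 ∨ x₄ = 1) (h₅ : x₅ = 0 ∨ x₅ = 1) (h₆ : x₆ = 0 ∨ x₆ = 1)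
    (h₁₂ : x₁ = 0 ∨ x₂ = 0) (h₂₃ : x₂ = 0 ∨ x₃ = 0) (h₃₄ : x₃ = 0 ∨ x₄ = 0)
    (h₄₅ : x₄ = 0 ∨ x₅ = 0) (h₅₆ : x₅ = 0 ∨ x₆ = 0)
    (hc : c₂ = 0 ∨ c₂ = 1) (hd : d₂ = 0 ∨ d₂ = 1) :
    0 ≤ 2 * 1 + 1 / 2 * c₂ + 1 / 2 * d₂
      - 1 / 2 * x₁ - 1 * x₂ - 3 / 2 * x₃ - 3 / 2 * x₄ - 1 * x₅ - 1 / 2 * x₆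
      + 1 / 4 * (x₁ * (x₃ - d₂) + x₆ * (x₄ - c₂)) + 1 / 4 * (x₂ * (x₄ - d₂) + x₅ * (x₃ - c₂))
      + 1 / 4 * (x₃ * (x₅ - d₂) + x₄ * (x₂ - c₂)) + 1 / 4 * (x₄ * (x₆ - d₂) + x₃ * (x₁ - c₂)) := by
  rcases hc with rfl | rfl <;> rcases hd with rfl | rfl <;>
  rcases h₁ with rfl | rfl <;> rcases h₂ with rfl | rfl <;> first | (norm_num at h₁₂; done) | skip
  all_goals rcases h₃ with rfl | rfl <;> first | (norm_num at h₂₃; done) | skip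
  all_goals rcases h₄ with rfl | rfl <;> first | (norm_num at h₃₄; done) | skip
  all_goals rcases h₅ with rfl | rfl <;> first | (norm_num at h₄₅; done) | skip
  all_goals rcases h₆ with rfl | rfl <;> first | (norm_num at h₅₆; done) | norm_num

-- `F` and `L` are the factors of the first and last entries. No product `F * L` occurs, so the
-- inequality is linear once the indicators are fixed.
set_option maxHeartbeats 2000000 in
theorem one_one_local (h₀ : x₀ = 0 ∨ x₀ = 1) (h₁ : x₁ = 0 ∨ x₁ = 1) (h₂ : x₂ = 0 ∨ x₂ = 1)
    (h₃ : x₃ = 0 ∨ x₃ = 1) (h₄ : x₄ = 0 ∨ x₄ = 1) (h₅ : x₅ = 0 ∨ x₅ = 1) (h₆ : x₆ = 0 ∨ x₆ = 1)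
    (h₀₁ : x₀ = 0 ∨ x₁ = 0) (h₁₂ : x₁ = 0 ∨ x₂ = 0) (h₂₃ : x₂ = 0 ∨ x₃ = 0)
    (h₃₄ : x₃ = 0 ∨ x₄ = 0) (h₄₅ : x₄ = 0 ∨ x₅ = 0) (h₅₆ : x₅ = 0 ∨ x₆ = 0)
    (hF : (c₂ = 1 ∧ c₃ = 0 ∧ F = 2) ∨ (c₂ = 0 ∧ c₃ = 1 ∧ F = 3 / 2) ∨
      (c₂ = 0 ∧ c₃ = 0 ∧ 1 ≤ F ∧ F ≤ 4 / 3))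
    (hL : (d₂ = 1 ∧ d₃ = 0 ∧ L = 2) ∨ (d₂ = 0 ∧ d₃ = 1 ∧ L = 3 / 2) ∨
      (d₂ = 0 ∧ d₃ = 0 ∧ 1 ≤ L ∧ L ≤ 4 / 3)) :
    0 ≤ 2 * 1 + F + L + 2 * c₂ + 2 * d₂ + 3 / 4 * c₃ + 3 / 4 * d₃
      + 1 / 2 * (c₂ * L) + 1 / 2 * (d₂ * F)
      - 1 / 2 * (x₁ * F) - 1 * (x₂ * F) - 3 / 2 * (x₃ * F) - 3 / 2 * (x₄ * F) - 1 * (x₅ * F)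
      - 1 / 2 * (x₆ * F)
      - 1 / 2 * (x₀ * L) - 1 * (x₁ * L) - 3 / 2 * (x₂ * L) - 3 / 2 * (x₃ * L) - 1 * (x₄ * L)
      - 1 / 2 * (x₅ * L)
      + 1 / 3 * (x₀ * (x₂ - d₂) + x₆ * (x₄ - c₂)) + 5 / 3 * (x₁ * (x₃ - d₂) + x₅ * (x₃ - c₂))
      + 4 / 3 * (x₂ * (x₄ - d₂) + x₄ * (x₂ - c₂)) + 1 / 3 * (x₃ * (x₅ - d₂) + x₃ * (x₁ - c₂))
      + 1 / 3 * (x₄ * (x₆ - d₂) + x₂ * (x₀ - c₂))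
      + 1 / 3 * (x₀ * (x₃ - d₃) + x₆ * (x₃ - c₃)) + 1 / 2 * (x₁ * (x₄ - d₃) + x₅ * (x₂ - c₃))
      + 1 / 6 * (x₂ * (x₅ - d₃) + x₄ * (x₁ - c₃)) := by
  rcases h₀ with rfl | rfl <;> rcases h₁ with rfl | rfl <;>
    first | (norm_num at h₀₁; done) | clear h₀₁
  all_goals rcases h₂ with rfl | rfl <;> first | (norm_num at h₁₂; done) | clear h₁₂
  all_goals rcases h₃ with rfl | rfl <;> first | (norm_num at h₂₃; done) | clear h₂₃
  all_goals rcases h₄ with rfl | rfl <;> first | (norm_num at h₃₄; done) | clear h₃₄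
  all_goals rcases h₅ with rfl | rfl <;> first | (norm_num at h₄₅; done) | clear h₄₅
  all_goals rcases h₆ with rfl | rfl <;> first | (norm_num at h₅₆; done) | clear h₅₆
  all_goals
    simp only [mul_zero, zero_mul, mul_one, one_mul, sub_zero, zero_sub, add_zero, zero_add]
    rcases hF with ⟨rfl, rfl, rfl⟩ | ⟨rfl, rfl, rfl⟩ | ⟨rfl, rfl, hF, hF'⟩ <;>
    rcases hL with ⟨rfl, rfl, rfl⟩ | ⟨rfl, rfl, rfl⟩ | ⟨rfl, rfl, hL, hL'⟩ <;>
    linarith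

set_option maxHeartbeats 2000000 in
theorem no_ones_local (h₁ : x₁ = 0 ∨ x₁ = 1) (h₂ : x₂ = 0 ∨ x₂ = 1) (h₃ : x₃ = 0 ∨ x₃ = 1)
    (h₄ : x₄ = 0 ∨ x₄ = 1) (h₅ : x₅ = 0 ∨ x₅ = 1) (h₆ : x₆ = 0 ∨ x₆ = 1)
    (h₁₂ : x₁ = 0 ∨ x₂ = 0) (h₂₃ : x₂ = 0 ∨ x₃ = 0) (h₃₄ : x₃ = 0 ∨ x₄ = 0)
    (h₄₅ : x₄ = 0 ∨ x₅ = 0) (h₅₆ : x₅ = 0 ∨ x₆ = 0)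
    (hF : (c₂ = 1 ∧ c₃ = 0 ∧ F = 2) ∨ (c₂ = 0 ∧ c₃ = 1 ∧ F = 3 / 2) ∨
      (c₂ = 0 ∧ c₃ = 0 ∧ 1 ≤ F ∧ F ≤ 4 / 3))
    (hL : (d₂ = 1 ∧ d₃ = 0 ∧ L = 2) ∨ (d₂ = 0 ∧ d₃ = 1 ∧ L = 3 / 2) ∨
      (d₂ = 0 ∧ d₃ = 0 ∧ 1 ≤ L ∧ L ≤ 4 / 3)) :
    0 ≤ F + L + 2 * (c₂ * L) + 2 * (d₂ * F) + 3 / 4 * (c₃ * L) + 3 / 4 * (d₃ * F)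
      - 1 / 2 * (x₁ * (F * L)) - 1 * (x₂ * (F * L)) - 3 / 2 * (x₃ * (F * L))
      - 3 / 2 * (x₄ * (F * L)) - 1 * (x₅ * (F * L)) - 1 / 2 * (x₆ * (F * L))
      + 1 / 3 * (x₁ * (x₃ - d₂) + x₆ * (x₄ - c₂)) + 2 / 3 * (x₂ * (x₄ - d₂) + x₅ * (x₃ - c₂))
      + 2 * (x₃ * (x₅ - d₂) + x₄ * (x₂ - c₂)) + 4 / 3 * (x₄ * (x₆ - d₂) + x₃ * (x₁ - c₂))
      + 1 / 2 * (x₁ * (x₄ - d₃) + x₆ * (x₃ - c₃)) + 4 / 9 * (x₂ * (x₅ - d₃) + x₅ * (x₂ - c₃))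
      + 5 / 6 * (x₃ * (x₆ - d₃) + x₄ * (x₁ - c₃)) := by
  rcases h₁ with rfl | rfl <;> rcases h₂ with rfl | rfl <;>
    first | (norm_num at h₁₂; done) | clear h₁₂
  all_goals rcases h₃ with rfl | rfl <;> first | (norm_num at h₂₃; done) | clear h₂₃
  all_goals rcases h₄ with rfl | rfl <;> first | (norm_num at h₃₄; done) | clear h₃₄
  all_goals rcases h₅ with rfl | rfl <;> first | (norm_num at h₄₅; done) | clear h₄₅
  all_goals rcases h₆ with rfl | rfl <;> first | (norm_num at h₅₆; done) | clear h₅₆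
  all_goals
    simp only [mul_zero, zero_mul, one_mul, sub_zero, zero_sub, add_zero, zero_add]
    rcases hF with ⟨rfl, rfl, rfl⟩ | ⟨rfl, rfl, rfl⟩ | ⟨rfl, rfl, hF, hF'⟩ <;>
    rcases hL with ⟨rfl, rfl, rfl⟩ | ⟨rfl, rfl, rfl⟩ | ⟨rfl, rfl, hL, hL'⟩ <;>
    first
    | linarith
    -- When `F` and `L` both range over [1, 4/3], the term `F * L` is controlled by the products of
    -- their interval constraints.
    | linarith [mul_nonneg (sub_nonneg.2 hF) (sub_nonneg.2 hL),
        mul_nonneg (sub_nonneg.2 hF') (sub_nonneg.2 hL'),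
        mul_nonneg (sub_nonneg.2 hF) (sub_nonneg.2 hL'),
        mul_nonneg (sub_nonneg.2 hF') (sub_nonneg.2 hL)]

end LocalInequalities

/-! ### Positivity of the coefficients of the powers of `e 1` -/

section Sectors

variable {R : Type*} [CommRing R] [Algebra ℚ R] (e : ℕ → R)

theorem ofNat_mul_eq_smul (n : ℕ) [n.AtLeastTwo] (a : R) :
    (ofNat(n) : R) * a = (ofNat(n) : ℚ) • a := by
  rw [Algebra.smul_def, map_ofNat]

/-- The element `a` of `R` is a linear combination with nonnegative coefficients of the weights of
the words of `n`. -/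
def IsWordPositive (n : ℕ) (a : R) : Prop :=
  ∃ φ : List ℕ → ℚ, (∀ K ∈ blockWords n, 0 ≤ φ K) ∧ a = wordSum e n φ

/-- The part of the expansion of the trinacria generating function without a factor `e 1`. -/
def noOnesPart (b : ℕ) : R :=
  2 * headSum e (2 * b + 7) + 4 * (e 2 * headSum e (2 * b + 5))
    + 3 * (e 3 * headSum e (2 * b + 4))
    - 3 * (headSum e (b + 3) * headSum e (b + 4))
    - 2 * (headSum e (b + 2) * headSum e (b + 5))
    - headSum e (b + 1) * headSum e (b + 6)

/-- The coefficient of `e 1` in the expansion of the trinacria generating function. -/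
def oneOnePart (b : ℕ) : R :=
  2 * weightSum e (2 * b + 6) + 2 * headSum e (2 * b + 6) + 4 * (e 2 * weightSum e (2 * b + 4))
    + 3 * (e 3 * weightSum e (2 * b + 3)) + e 2 * headSum e (2 * b + 4)
    - 3 * (weightSum e (b + 2) * headSum e (b + 4) + weightSum e (b + 3) * headSum e (b + 3))
    - 2 * (weightSum e (b + 1) * headSum e (b + 5) + weightSum e (b + 4) * headSum e (b + 2))
    - (weightSum e b * headSum e (b + 6) + weightSum e (b + 5) * headSum e (b + 1))

/-- The coefficient of `e 1 ^ 2` in the expansion of the trinacria generating function. -/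
def twoOnesPart (b : ℕ) : R :=
  2 * weightSum e (2 * b + 5) + e 2 * weightSum e (2 * b + 3)
    - 3 * (weightSum e (b + 2) * weightSum e (b + 3))
    - 2 * (weightSum e (b + 1) * weightSum e (b + 4))
    - weightSum e b * weightSum e (b + 5)

theorem isWordPositive_two_ones (b : ℕ) :
    IsWordPositive e (2 * b + 5) (twoOnesPart e b) := by
  -- Each product is shared equally between its two orders, whence the halved coefficients; the `1`
  -- in `2 * 1` is the constant function summing to `weightSum`. The reversal terms sum to zero, so
  -- their coefficients only have to satisfy `two_ones_local`.
  refine ⟨fun K => 2 * 1 + 1 / 2 * breakInd 2 K + 1 / 2 * breakInd (2 * b + 3) K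
      - 1 / 2 * breakInd b K - 1 * breakInd (b + 1) K - 3 / 2 * breakInd (b + 2) K
      - 3 / 2 * breakInd (b + 3) K - 1 * breakInd (b + 4) K - 1 / 2 * breakInd (b + 5) K
      + 1 / 4 * reversalTerm 2 b (b + 3) (b + 2) (2 * b + 3) (b + 5) K
      + 1 / 4 * reversalTerm 2 (b + 1) (b + 2) (b + 3) (2 * b + 3) (b + 4) K
      + 1 / 4 * reversalTerm 2 (b + 2) (b + 1) (b + 4) (2 * b + 3) (b + 3) K
      + 1 / 4 * reversalTerm 2 (b + 3) b (b + 5) (2 * b + 3) (b + 2) K, fun K hK => ?_, ?_⟩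
  · have hm := (mem_blockWords.1 hK).1
    have h := breakInd_eq_zero_or_one (K := K)
    exact two_ones_local (h _) (h _) (h _) (h _) (h _) (h _) (breakInd_mul_succ hm)
      (breakInd_mul_succ hm) (breakInd_mul_succ hm) (breakInd_mul_succ hm) (breakInd_mul_succ hm)
      (h _) (h _)
  · simp only [twoOnesPart, wordSum_add, wordSum_sub, wordSum_mul]
    rw [wordSum_breakInd e (k := 2) (l := 2 * b + 3) (by omega),
      (wordSum_breakInd e (k := 2 * b + 3) (l := 2) (by omega)).trans (mul_comm _ _),
      wordSum_breakInd e (k := b) (l := b + 5) (by omega),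
      wordSum_breakInd e (k := b + 1) (l := b + 4) (by omega),
      wordSum_breakInd e (k := b + 2) (l := b + 3) (by omega),
      (wordSum_breakInd e (k := b + 3) (l := b + 2) (by omega)).trans (mul_comm _ _),
      (wordSum_breakInd e (k := b + 4) (l := b + 1) (by omega)).trans (mul_comm _ _),
      (wordSum_breakInd e (k := b + 5) (l := b) (by omega)).trans (mul_comm _ _),
      wordSum_reversalTerm e (by omega) (by omega) (by omega) (by omega),
      wordSum_reversalTerm e (by omega) (by omega) (by omega) (by omega),
      wordSum_reversalTerm e (by omega) (by omega) (by omega) (by omega),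
      wordSum_reversalTerm e (by omega) (by omega) (by omega) (by omega), weightSum_two]
    rw [← weightSum]
    simp only [ofNat_mul_eq_smul]
    module

theorem isWordPositive_one_one (b : ℕ) :
    IsWordPositive e (2 * b + 6) (oneOnePart e b) := by
  -- The coefficient 3/4 occurs at both ends and `weightSum e 3 = 2 * e 3`, which together give the
  -- 3 in front of `e 3`.
  refine ⟨fun K => 2 * 1 + headFactor K + lastFactor K
      + 2 * breakInd 2 K + 2 * breakInd (2 * b + 4) K
      + 3 / 4 * breakInd 3 K + 3 / 4 * breakInd (2 * b + 3) K
      + 1 / 2 * (breakInd 2 K * lastFactor K) + 1 / 2 * (breakInd (2 * b + 4) K * headFactor K)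
      - 1 / 2 * (breakInd (b + 1) K * headFactor K) - 1 * (breakInd (b + 2) K * headFactor K)
      - 3 / 2 * (breakInd (b + 3) K * headFactor K) - 3 / 2 * (breakInd (b + 4) K * headFactor K)
      - 1 * (breakInd (b + 5) K * headFactor K) - 1 / 2 * (breakInd (b + 6) K * headFactor K)
      - 1 / 2 * (breakInd b K * lastFactor K) - 1 * (breakInd (b + 1) K * lastFactor K)
      - 3 / 2 * (breakInd (b + 2) K * lastFactor K) - 3 / 2 * (breakInd (b + 3) K * lastFactor K)
      - 1 * (breakInd (b + 4) K * lastFactor K) - 1 / 2 * (breakInd (b + 5) K * lastFactor K)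
      + 1 / 3 * reversalTerm 2 b (b + 4) (b + 2) (2 * b + 4) (b + 6) K
      + 5 / 3 * reversalTerm 2 (b + 1) (b + 3) (b + 3) (2 * b + 4) (b + 5) K
      + 4 / 3 * reversalTerm 2 (b + 2) (b + 2) (b + 4) (2 * b + 4) (b + 4) K
      + 1 / 3 * reversalTerm 2 (b + 3) (b + 1) (b + 5) (2 * b + 4) (b + 3) K
      + 1 / 3 * reversalTerm 2 (b + 4) b (b + 6) (2 * b + 4) (b + 2) K
      + 1 / 3 * reversalTerm 3 b (b + 3) (b + 3) (2 * b + 3) (b + 6) K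
      + 1 / 2 * reversalTerm 3 (b + 1) (b + 2) (b + 4) (2 * b + 3) (b + 5) K
      + 1 / 6 * reversalTerm 3 (b + 2) (b + 1) (b + 5) (2 * b + 3) (b + 4) K, fun K hK => ?_, ?_⟩
  · have hm := (mem_blockWords.1 hK).1
    have h := breakInd_eq_zero_or_one (K := K)
    exact one_one_local (h _) (h _) (h _) (h _) (h _) (h _) (h _) (breakInd_mul_succ hm)
      (breakInd_mul_succ hm) (breakInd_mul_succ hm) (breakInd_mul_succ hm) (breakInd_mul_succ hm)
      (breakInd_mul_succ hm) (headFactor_cases (by omega) hK)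
      (lastFactor_cases (by omega) (by omega) hK)
  · simp only [oneOnePart, wordSum_add, wordSum_sub, wordSum_mul]
    rw [wordSum_breakInd e (k := 2) (l := 2 * b + 4) (by omega),
      (wordSum_breakInd e (k := 2 * b + 4) (l := 2) (by omega)).trans (mul_comm _ _),
      wordSum_breakInd e (k := 3) (l := 2 * b + 3) (by omega),
      (wordSum_breakInd e (k := 2 * b + 3) (l := 3) (by omega)).trans (mul_comm _ _),
      wordSum_breakInd_mul_lastFactor e (k := 2) (l := 2 * b + 4) (by omega) (by omega),
      wordSum_breakInd_mul_headFactor e (k := 2 * b + 4) (l := 2) (by omega) (by omega),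
      wordSum_breakInd_mul_headFactor e (k := b + 1) (l := b + 5) (by omega) (by omega),
      wordSum_breakInd_mul_headFactor e (k := b + 2) (l := b + 4) (by omega) (by omega),
      wordSum_breakInd_mul_headFactor e (k := b + 3) (l := b + 3) (by omega) (by omega),
      wordSum_breakInd_mul_headFactor e (k := b + 4) (l := b + 2) (by omega) (by omega),
      wordSum_breakInd_mul_headFactor e (k := b + 5) (l := b + 1) (by omega) (by omega),
      wordSum_breakInd_mul_headFactor e (k := b + 6) (l := b) (by omega) (by omega),
      wordSum_breakInd_mul_lastFactor e (k := b) (l := b + 6) (by omega) (by omega),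
      wordSum_breakInd_mul_lastFactor e (k := b + 1) (l := b + 5) (by omega) (by omega),
      wordSum_breakInd_mul_lastFactor e (k := b + 2) (l := b + 4) (by omega) (by omega),
      wordSum_breakInd_mul_lastFactor e (k := b + 3) (l := b + 3) (by omega) (by omega),
      wordSum_breakInd_mul_lastFactor e (k := b + 4) (l := b + 2) (by omega) (by omega),
      wordSum_breakInd_mul_lastFactor e (k := b + 5) (l := b + 1) (by omega) (by omega),
      wordSum_reversalTerm e (by omega) (by omega) (by omega) (by omega),
      wordSum_reversalTerm e (by omega) (by omega) (by omega) (by omega),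
      wordSum_reversalTerm e (by omega) (by omega) (by omega) (by omega),
      wordSum_reversalTerm e (by omega) (by omega) (by omega) (by omega),
      wordSum_reversalTerm e (by omega) (by omega) (by omega) (by omega),
      wordSum_reversalTerm e (by omega) (by omega) (by omega) (by omega),
      wordSum_reversalTerm e (by omega) (by omega) (by omega) (by omega),
      wordSum_reversalTerm e (by omega) (by omega) (by omega) (by omega), weightSum_two,
      weightSum_three]
    rw [← weightSum, wordSum_lastFactor, ← headSum]
    simp only [ofNat_mul_eq_smul, smul_mul_assoc]
    module

theorem isWordPositive_no_ones (b : ℕ) :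
    IsWordPositive e (2 * b + 7) (noOnesPart e b) := by
  refine ⟨fun K => headFactor K + lastFactor K
      + 2 * (breakInd 2 K * lastFactor K) + 2 * (breakInd (2 * b + 5) K * headFactor K)
      + 3 / 4 * (breakInd 3 K * lastFactor K) + 3 / 4 * (breakInd (2 * b + 4) K * headFactor K)
      - 1 / 2 * (breakInd (b + 1) K * (headFactor K * lastFactor K))
      - 1 * (breakInd (b + 2) K * (headFactor K * lastFactor K))
      - 3 / 2 * (breakInd (b + 3) K * (headFactor K * lastFactor K))
      - 3 / 2 * (breakInd (b + 4) K * (headFactor K * lastFactor K))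
      - 1 * (breakInd (b + 5) K * (headFactor K * lastFactor K))
      - 1 / 2 * (breakInd (b + 6) K * (headFactor K * lastFactor K))
      + 1 / 3 * reversalTerm 2 (b + 1) (b + 4) (b + 3) (2 * b + 5) (b + 6) K
      + 2 / 3 * reversalTerm 2 (b + 2) (b + 3) (b + 4) (2 * b + 5) (b + 5) K
      + 2 * reversalTerm 2 (b + 3) (b + 2) (b + 5) (2 * b + 5) (b + 4) K
      + 4 / 3 * reversalTerm 2 (b + 4) (b + 1) (b + 6) (2 * b + 5) (b + 3) K
      + 1 / 2 * reversalTerm 3 (b + 1) (b + 3) (b + 4) (2 * b + 4) (b + 6) K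
      + 4 / 9 * reversalTerm 3 (b + 2) (b + 2) (b + 5) (2 * b + 4) (b + 5) K
      + 5 / 6 * reversalTerm 3 (b + 3) (b + 1) (b + 6) (2 * b + 4) (b + 4) K, fun K hK => ?_, ?_⟩
  · have hm := (mem_blockWords.1 hK).1
    have h := breakInd_eq_zero_or_one (K := K)
    exact no_ones_local (h _) (h _) (h _) (h _) (h _) (h _) (breakInd_mul_succ hm)
      (breakInd_mul_succ hm) (breakInd_mul_succ hm) (breakInd_mul_succ hm) (breakInd_mul_succ hm)
      (headFactor_cases (by omega) hK) (lastFactor_cases (by omega) (by omega) hK)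
  · simp only [noOnesPart, wordSum_add, wordSum_sub, wordSum_mul]
    rw [wordSum_breakInd_mul_lastFactor e (k := 2) (l := 2 * b + 5) (by omega) (by omega),
      wordSum_breakInd_mul_headFactor e (k := 2 * b + 5) (l := 2) (by omega) (by omega),
      wordSum_breakInd_mul_lastFactor e (k := 3) (l := 2 * b + 4) (by omega) (by omega),
      wordSum_breakInd_mul_headFactor e (k := 2 * b + 4) (l := 3) (by omega) (by omega),
      wordSum_breakInd_mul_headFactor_mul_lastFactor e (k := b + 1) (l := b + 6) (by omega)
        (by omega) (by omega),
      wordSum_breakInd_mul_headFactor_mul_lastFactor e (k := b + 2) (l := b + 5) (by omega)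
        (by omega) (by omega),
      wordSum_breakInd_mul_headFactor_mul_lastFactor e (k := b + 3) (l := b + 4) (by omega)
        (by omega) (by omega),
      (wordSum_breakInd_mul_headFactor_mul_lastFactor e (k := b + 4) (l := b + 3) (by omega)
        (by omega) (by omega)).trans (mul_comm _ _),
      (wordSum_breakInd_mul_headFactor_mul_lastFactor e (k := b + 5) (l := b + 2) (by omega)
        (by omega) (by omega)).trans (mul_comm _ _),
      (wordSum_breakInd_mul_headFactor_mul_lastFactor e (k := b + 6) (l := b + 1) (by omega)
        (by omega) (by omega)).trans (mul_comm _ _),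
      wordSum_reversalTerm e (by omega) (by omega) (by omega) (by omega),
      wordSum_reversalTerm e (by omega) (by omega) (by omega) (by omega),
      wordSum_reversalTerm e (by omega) (by omega) (by omega) (by omega),
      wordSum_reversalTerm e (by omega) (by omega) (by omega) (by omega),
      wordSum_reversalTerm e (by omega) (by omega) (by omega) (by omega),
      wordSum_reversalTerm e (by omega) (by omega) (by omega) (by omega),
      wordSum_reversalTerm e (by omega) (by omega) (by omega) (by omega), weightSum_two,
      weightSum_three]
    rw [wordSum_lastFactor, ← headSum]
    simp only [ofNat_mul_eq_smul, smul_mul_assoc]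
    module

end Sectors

theorem sum_range_succ_eq_add_add_sum_Icc {M : Type*} [AddCommMonoid M] {n : ℕ} (hn : 0 < n)
    (f : ℕ → M) : ∑ i ∈ range (n + 1), f i = f 0 + f 1 + ∑ i ∈ Icc 2 n, f i := by
  rw [range_eq_Ico, sum_eq_sum_Ico_succ_bot (by omega), sum_eq_sum_Ico_succ_bot (by omega),
    ← add_assoc]
  rfl

/-! ### Generating functions of paths and of the trinacria graph -/

section Paths

variable {ι R : Type*} [Fintype ι] [CommRing R] (x : ι → R)

/-- The elementary symmetric polynomials in the `x c`. -/
def elemSum (k : ℕ) : R := ∑ t ∈ powersetCard k (univ : Finset ι), ∏ c ∈ t, x c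

/-- The generating function of the proper colourings of the path on `m + 1` vertices whose first
vertex has colour `c`. -/
def pathFrom : ℕ → ι → R
  | 0, c => x c
  | m + 1, c => x c * (∑ c', pathFrom m c' - pathFrom m c)

/-- The generating function of the proper colourings of the path on `m + 1` vertices. -/
def pathSum (m : ℕ) : R := ∑ c, pathFrom x m c

theorem pathFrom_succ (m : ℕ) (c : ι) :
    pathFrom x (m + 1) c = x c * (pathSum x m - pathFrom x m c) := rfl

theorem elemSum_zero : elemSum x 0 = 1 := by simp [elemSum]

/-- The generating polynomial of the `elemSum x k`. -/
noncomputable def elemPoly : Polynomial R :=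
  ∏ c, (1 + Polynomial.C (x c) * Polynomial.X)

theorem coeff_elemPoly (n : ℕ) : (elemPoly x).coeff n = elemSum x n := by
  classical
  rw [elemPoly, prod_one_add, Polynomial.finsetSum_coeff, elemSum, powersetCard_eq_filter,
    sum_filter]
  refine sum_congr rfl fun t _ => ?_
  rw [prod_mul_distrib, prod_const, ← map_prod, Polynomial.coeff_C_mul_X_pow]
  simp only [eq_comm]

theorem coeff_X_mul_derivative_elemPoly (n : ℕ) :
    PowerSeries.coeff n (PowerSeries.X * ((elemPoly x).derivative : PowerSeries R)) =
      n * elemSum x n := by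
  cases n with
  | zero => simp
  | succ n =>
    rw [PowerSeries.coeff_succ_X_mul, Polynomial.coeff_coe, Polynomial.coeff_derivative,
      coeff_elemPoly, mul_comm]
    push_cast
    rfl

/-- The series F_c of the `pathFrom x m c` satisfies (1 + x_c z) F_c = x_c (1 + zP). Divide by 1 +
x_c z and sum over c, using E'/E = ∑ x_c / (1 + x_c z). -/
theorem elemPoly_mul_mk_pathSum :
    (elemPoly x : PowerSeries R) * PowerSeries.mk (pathSum x) =
      ((elemPoly x).derivative : PowerSeries R) *
        (1 + PowerSeries.X * PowerSeries.mk (pathSum x)) := by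
  classical
  have h1 : PowerSeries.mk (pathSum x) = ∑ c, PowerSeries.mk (fun m => pathFrom x m c) := by
    ext n
    simp [pathSum]
  have h2 : ∀ c, (1 + PowerSeries.C (x c) * PowerSeries.X) *
      PowerSeries.mk (fun m => pathFrom x m c) =
      PowerSeries.C (x c) * (1 + PowerSeries.X * PowerSeries.mk (pathSum x)) := by
    intro c
    ext n
    cases n with
    | zero => simp [add_mul, mul_assoc, pathFrom]
    | succ n =>
      simp only [add_mul, one_mul, mul_assoc, map_add, PowerSeries.coeff_C_mul,
        PowerSeries.coeff_succ_X_mul, PowerSeries.coeff_mk, pathFrom_succ, mul_add, mul_one,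
        PowerSeries.coeff_succ_C]
      ring
  have h3 : (elemPoly x).derivative =
      ∑ c, (∏ i ∈ univ.erase c, (1 + Polynomial.C (x i) * Polynomial.X)) * Polynomial.C (x c) := by
    rw [elemPoly, Polynomial.derivative_prod_finset]
    simp
  have h4 : ∀ c, (elemPoly x : PowerSeries R) =
      ((∏ i ∈ univ.erase c, (1 + Polynomial.C (x i) * Polynomial.X) : Polynomial R) :
        PowerSeries R) * (1 + PowerSeries.C (x c) * PowerSeries.X) := by
    intro c
    rw [elemPoly, ← prod_erase_mul _ _ (mem_univ c), Polynomial.coe_mul]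
    simp
  rw [h3, h1, mul_sum, ← Polynomial.coeToPowerSeries.ringHom_apply (φ := ∑ c, _), map_sum, sum_mul]
  refine sum_congr rfl fun c _ => ?_
  rw [← h1, h4 c, mul_assoc, h2, Polynomial.coeToPowerSeries.ringHom_apply, Polynomial.coe_mul,
    Polynomial.coe_C, mul_assoc]

/-- Pairs of coloured paths whose first colours differ are the colourings of the path obtained by
joining the first vertices. The induction moves one vertex at a time from one path to the other. -/
theorem sum_pathFrom_mul_pathFrom (a b : ℕ) :
    ∑ c, pathFrom x a c * pathFrom x b c = pathSum x a * pathSum x b - pathSum x (a + b + 1) := by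
  have h0 (a : ℕ) : ∑ c, pathFrom x a c * pathFrom x 0 c =
      pathSum x a * pathSum x 0 - pathSum x (a + 1) := by
    have h : ∀ c, pathFrom x a c * pathFrom x 0 c =
        pathSum x a * pathFrom x 0 c - pathFrom x (a + 1) c := fun c => by
      rw [pathFrom_succ, pathFrom]
      ring
    simp only [h, sum_sub_distrib, ← mul_sum]
    rfl
  induction b generalizing a with
  | zero => exact h0 a
  | succ b ih =>
    have h : ∀ c, pathFrom x a c * pathFrom x (b + 1) c =
        pathFrom x (a + 1) c * pathFrom x b c - pathSum x a * (pathFrom x 0 c * pathFrom x b c) +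
          pathSum x b * (pathFrom x a c * pathFrom x 0 c) := fun c => by
      rw [pathFrom_succ, pathFrom_succ, pathFrom]
      ring
    simp only [h, sum_sub_distrib, sum_add_distrib, ← mul_sum, ih, h0]
    rw [show a + 1 + b + 1 = a + (b + 1) + 1 by ring, show 0 + b + 1 = b + 1 by ring]
    ring

/-- The generating function of the proper colourings of the trinacria graph. -/
def trinacriaSum [DecidableEq ι] (a b c : ℕ) : R :=
  ∑ i, ∑ j, ∑ k, if i ≠ j ∧ i ≠ k ∧ j ≠ k then
    pathFrom x a i * (pathFrom x b j * pathFrom x c k) else 0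

/-- Möbius inversion on the partitions of the three triangle vertices: -1 for each coinciding pair,
2 for all three. -/
theorem trinacriaSum_eq [DecidableEq ι] (a b c : ℕ) :
    trinacriaSum x a b c =
      pathSum x a * pathSum x b * pathSum x c
        - (∑ i, pathFrom x a i * pathFrom x b i) * pathSum x c
        - (∑ i, pathFrom x a i * pathFrom x c i) * pathSum x b
        - (∑ i, pathFrom x b i * pathFrom x c i) * pathSum x a
        + 2 * ∑ i, pathFrom x a i * pathFrom x b i * pathFrom x c i := by
  have h : ∀ i j k, (if i ≠ j ∧ i ≠ k ∧ j ≠ k then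
      pathFrom x a i * (pathFrom x b j * pathFrom x c k) else 0) =
      pathFrom x a i * pathFrom x b j * pathFrom x c k
      - (if i = j then pathFrom x a i * pathFrom x b j * pathFrom x c k else 0)
      - (if i = k then pathFrom x a i * pathFrom x b j * pathFrom x c k else 0)
      - (if j = k then pathFrom x a i * pathFrom x b j * pathFrom x c k else 0)
      + 2 * (if i = j then if i = k then pathFrom x a i * pathFrom x b j * pathFrom x c k else 0
        else 0) := by
    intro i j k
    by_cases hij : i = j <;> by_cases hik : i = k <;> by_cases hjk : j = k <;>
      simp_all <;> ring
  simp only [trinacriaSum, h, sum_add_distrib, sum_sub_distrib, ← mul_sum, sum_ite_eq,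
    sum_ite_irrel, sum_const_zero, mem_univ, if_true]
  have e1 : ∑ i, ∑ j, ∑ k, pathFrom x a i * pathFrom x b j * pathFrom x c k =
      pathSum x a * pathSum x b * pathSum x c := by
    simp only [pathSum, ← mul_sum, ← sum_mul]
  have e2 : ∑ i, ∑ k, pathFrom x a i * pathFrom x b i * pathFrom x c k =
      (∑ i, pathFrom x a i * pathFrom x b i) * pathSum x c := by
    simp only [pathSum, sum_mul_sum]
  have e3 : ∑ i, ∑ j, pathFrom x a i * pathFrom x b j * pathFrom x c i =
      (∑ i, pathFrom x a i * pathFrom x c i) * pathSum x b := by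
    simp only [pathSum, sum_mul_sum, mul_right_comm]
  have e4 : ∑ i, ∑ j, pathFrom x a i * pathFrom x b j * pathFrom x c j =
      (∑ i, pathFrom x b i * pathFrom x c i) * pathSum x a := by
    rw [mul_comm]
    simp only [pathSum, sum_mul_sum, mul_assoc]
  simp only [← mul_sum, ← sum_mul] at e1 e2 e3 e4 ⊢
  simp only [e1, e2, e3, e4]

theorem trinacriaSum_add_two (b : ℕ) [DecidableEq ι] :
    trinacriaSum x (b + 2) b 2 =
      2 * pathSum x (2 * b + 6) + 2 * (pathSum x 0 * pathSum x (2 * b + 5))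
        + 2 * (pathSum x 1 * pathSum x (2 * b + 4)) + pathSum x 2 * pathSum x (2 * b + 3)
        - 3 * (pathSum x (b + 2) * pathSum x (b + 3)) - 2 * (pathSum x (b + 1) * pathSum x (b + 4))
        - pathSum x b * pathSum x (b + 5) := by
  -- Expand `pathFrom x 2 i` as x P_1 - x² P_0 + x³ and absorb each x into `pathFrom x (b + 2) i`,
  -- raising its index. Only products of two `pathFrom`s remain.
  have h : ∀ i, pathFrom x (b + 2) i * pathFrom x b i * pathFrom x 2 i =
      pathSum x 1 * (pathSum x (b + 2) * (pathFrom x b i * pathFrom x 0 i)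
        - pathFrom x (b + 3) i * pathFrom x b i)
      - pathSum x 0 * (pathSum x (b + 2) * (pathSum x 0 * (pathFrom x b i * pathFrom x 0 i)
        - pathFrom x b i * pathFrom x 1 i) - pathSum x (b + 3) * (pathFrom x b i * pathFrom x 0 i)
        + pathFrom x (b + 4) i * pathFrom x b i)
      + (pathSum x (b + 2) * (pathFrom x b i * pathFrom x 2 i
          - pathSum x 1 * (pathFrom x b i * pathFrom x 0 i)
          + pathSum x 0 * (pathSum x 0 * (pathFrom x b i * pathFrom x 0 i)
            - pathFrom x b i * pathFrom x 1 i))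
        - pathSum x (b + 3) * (pathSum x 0 * (pathFrom x b i * pathFrom x 0 i)
          - pathFrom x b i * pathFrom x 1 i)
        + pathSum x (b + 4) * (pathFrom x b i * pathFrom x 0 i)
        - pathFrom x (b + 5) i * pathFrom x b i) := by
    intro i
    rw [pathFrom_succ x (b + 4), pathFrom_succ x (b + 3), pathFrom_succ x (b + 2),
      pathFrom_succ x 1, pathFrom_succ x 0, pathFrom]
    ring
  rw [trinacriaSum_eq]
  simp only [h, sum_add_distrib, sum_sub_distrib, ← mul_sum, sum_pathFrom_mul_pathFrom]
  ring_nf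

variable [Algebra ℚ R]

/-- The coefficient of z^n in E - zE' is (1 - n) e_n, so e_1 drops out and the inverse is a
geometric series over words. -/
theorem mk_weightSum_mul :
    ((elemPoly x : PowerSeries R) - PowerSeries.X * ((elemPoly x).derivative : PowerSeries R)) *
      PowerSeries.mk (weightSum (elemSum x)) = 1 := by
  ext n
  rw [PowerSeries.coeff_mul, Nat.sum_antidiagonal_eq_sum_range_succ_mk, PowerSeries.coeff_one]
  simp only [map_sub, coeff_X_mul_derivative_elemPoly, Polynomial.coeff_coe, coeff_elemPoly,
    PowerSeries.coeff_mk]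
  rcases Nat.eq_zero_or_pos n with rfl | hn
  · simp [elemSum_zero, weightSum_zero]
  · rw [if_neg (by omega), sum_range_succ_eq_add_add_sum_Icc hn, elemSum_zero, Nat.sub_zero,
      weightSum_eq (elemSum x) hn]
    simp only [Nat.cast_zero, Nat.cast_one, zero_mul, one_mul, sub_zero, sub_self, add_zero]
    rw [← sum_add_distrib]
    refine sum_eq_zero fun i _ => ?_
    rw [Algebra.smul_def, map_sub, map_natCast, map_one]
    ring

/-- From P = E' / (E - zE'): the e_1 term of zE' gives the second summand, and the terms i e_i with
i ≥ 2 give `headSum`. -/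
theorem pathSum_eq (m : ℕ) :
    pathSum x m = headSum (elemSum x) (m + 1) + elemSum x 1 * weightSum (elemSum x) m := by
  have h : PowerSeries.X * PowerSeries.mk (pathSum x) =
      PowerSeries.X * ((elemPoly x).derivative : PowerSeries R) *
        PowerSeries.mk (weightSum (elemSum x)) := by
    linear_combination (-PowerSeries.X * PowerSeries.mk (pathSum x)) * mk_weightSum_mul x +
      PowerSeries.X * PowerSeries.mk (weightSum (elemSum x)) * elemPoly_mul_mk_pathSum x
  have h' := congrArg (PowerSeries.coeff (m + 1)) h
  rw [PowerSeries.coeff_succ_X_mul, PowerSeries.coeff_mk, PowerSeries.coeff_mul,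
    Nat.sum_antidiagonal_eq_sum_range_succ_mk] at h'
  simp only [coeff_X_mul_derivative_elemPoly, PowerSeries.coeff_mk] at h'
  rw [h', sum_range_succ_eq_add_add_sum_Icc (by omega), headSum_eq _ (by omega),
    Nat.add_sub_cancel]
  simp only [Nat.cast_zero, Nat.cast_one, zero_mul, one_mul, zero_add]
  rw [add_comm]
  congr 1
  refine sum_congr rfl fun i _ => ?_
  rw [Algebra.smul_def, map_natCast, mul_assoc]

end Paths

section Expansion

variable {R : Type*} [CommRing R] [Algebra ℚ R]

/-- Here P_0 = e_1, P_1 = 2 e_2 and P_2 = 3 e_3 + e_1 e_2, while every P_m has explicit degree at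
most one in e_1. -/
theorem trinacriaSum_expansion {ι : Type*} [Fintype ι] [DecidableEq ι] (x : ι → R) (b : ℕ) :
    trinacriaSum x (b + 2) b 2 =
      noOnesPart (elemSum x) b + elemSum x 1 * oneOnePart (elemSum x) b
        + elemSum x 1 * (elemSum x 1 * twoOnesPart (elemSum x) b) := by
  rw [trinacriaSum_add_two]
  simp only [pathSum_eq, zero_add, Nat.reduceAdd, headSum_one, headSum_two, headSum_three,
    weightSum_zero, weightSum_one, weightSum_two, noOnesPart, oneOnePart, twoOnesPart]
  ring

end Expansion

/-! ### Colourings of the trinacria graph, arm by arm -/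

section Colourings

theorem trinacria_proper_iff {ι : Type*} {a b c : ℕ} (κ : (Σ i : Fin 3, Fin (![a, b, c] i + 1)) → ι) :
    (∀ u v, (SimpleGraph.trinacria a b c).Adj u v → κ u ≠ κ v) ↔
      (∀ i, ∀ j : Fin (![a, b, c] i), κ ⟨i, j.castSucc⟩ ≠ κ ⟨i, j.succ⟩) ∧
        ∀ i i', i ≠ i' → κ ⟨i, 0⟩ ≠ κ ⟨i', 0⟩ := by
  constructor
  · intro h
    exact ⟨fun i j => h _ _ (Or.inl ⟨rfl, Or.inl (by simp)⟩),
      fun i i' hi => h _ _ (Or.inr ⟨hi, by simp, by simp⟩)⟩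
  · rintro ⟨h1, h2⟩
    have key : ∀ i, ∀ j j' : Fin (![a, b, c] i + 1), (j : ℕ) + 1 = j' → κ ⟨i, j⟩ ≠ κ ⟨i, j'⟩ := by
      intro i j j' hj
      have hlt := j'.isLt
      rw [show j' = (⟨j, by omega⟩ : Fin (![a, b, c] i)).succ from Fin.ext hj.symm]
      exact h1 i ⟨j, by omega⟩
    rintro ⟨i, j⟩ ⟨i', j'⟩ (⟨hi, hj⟩ | ⟨hi, hj, hj'⟩)
    · obtain rfl : i = i' := hi
      rcases hj with hj | hj
      exacts [key i j j' hj, (key i j' j hj).symm]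
    · obtain rfl : j = 0 := Fin.ext hj
      obtain rfl : j' = 0 := Fin.ext hj'
      exact h2 i i' hi

variable {ι R : Type*} [DecidableEq ι] [CommRing R] (x : ι → R)

/-- The monomial of a colouring of a path, or zero if the colouring is not proper. -/
def pathWeight {m : ℕ} (f : Fin (m + 1) → ι) : R :=
  (∏ i : Fin m, if f i.castSucc ≠ f i.succ then 1 else 0) * ∏ i, x (f i)

theorem pathWeight_cons {m : ℕ} (c : ι) (f : Fin (m + 1) → ι) :
    pathWeight x (Fin.cons c f : Fin (m + 2) → ι) =
      x c * (pathWeight x f - if f 0 = c then pathWeight x f else 0) := by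
  rw [pathWeight, Fin.prod_univ_succ, Fin.prod_univ_succ (n := m + 1)]
  simp only [Fin.castSucc_zero, Fin.cons_zero, Fin.cons_succ, ← Fin.succ_castSucc, ne_comm (a := c)]
  rw [pathWeight]
  by_cases h : f 0 = c
  · simp [h]
  · simp only [h, ne_eq, not_false_eq_true, if_true, if_false]
    ring

variable [Fintype ι]

theorem sum_pathWeight (m : ℕ) (c : ι) :
    ∑ f : Fin (m + 1) → ι, (if f 0 = c then pathWeight x f else 0) = pathFrom x m c := by
  induction m generalizing c with
  | zero =>
    rw [← (Equiv.funUnique (Fin 1) ι).symm.sum_comp]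
    simp [pathWeight, pathFrom]
  | succ m ih =>
    rw [← (Fin.consEquiv fun _ : Fin (m + 2) => ι).sum_comp, Fintype.sum_prod_type]
    have h : ∀ c' (f : Fin (m + 1) → ι), (if (Fin.consEquiv fun _ : Fin (m + 2) => ι) (c', f) 0 = c
        then pathWeight x ((Fin.consEquiv fun _ : Fin (m + 2) => ι) (c', f)) else 0) =
        if c' = c then x c' * (pathWeight x f - if f 0 = c' then pathWeight x f else 0) else 0 :=
      fun c' f => by rw [← pathWeight_cons]; rfl
    simp only [h]
    rw [sum_eq_single c (fun c' _ hc => by simp [hc]) (by simp)]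
    simp only [if_true, ← mul_sum, sum_sub_distrib, ih]
    rw [pathFrom_succ, pathSum]
    simp only [← ih]
    rw [sum_comm]
    simp

open scoped Classical in
/-- The generating function of the proper colourings of a graph with colours in `ι`. -/
noncomputable def colouringSum {V : Type*} [Fintype V] [DecidableEq V]
    (G : SimpleGraph V) : R :=
  ∑ κ : V → ι, if ∀ u v, G.Adj u v → κ u ≠ κ v then ∏ v, x (κ v) else 0

/-- Once the colours `s` of the triangle vertices are fixed, the three arms are coloured
independently. -/
theorem colouringSum_trinacria (a b c : ℕ) :
    colouringSum x (SimpleGraph.trinacria a b c) = trinacriaSum x a b c := by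
  classical
  have h1 : colouringSum x (SimpleGraph.trinacria a b c) =
      ∑ κ : (i : Fin 3) → Fin (![a, b, c] i + 1) → ι, ∑ s : Fin 3 → ι,
        (if ∀ i i', i ≠ i' → s i ≠ s i' then
          ∏ i, (if κ i 0 = s i then pathWeight x (κ i) else 0) else 0) := by
    rw [colouringSum, ← (Equiv.piCurry fun (i : Fin 3) (_ : Fin (![a, b, c] i + 1)) => ι).sum_comp]
    refine sum_congr rfl fun κ _ => ?_
    -- Only the `s` read off from `κ` contributes.
    rw [sum_eq_single (fun i => κ ⟨i, 0⟩)]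
    · have hw : ∀ i, (if Equiv.piCurry (fun _ _ => ι) κ i 0 = κ ⟨i, 0⟩ then
          pathWeight x (Equiv.piCurry (fun _ _ => ι) κ i) else 0) =
          (∏ j : Fin (![a, b, c] i), if κ ⟨i, j.castSucc⟩ ≠ κ ⟨i, j.succ⟩ then 1 else 0) *
            ∏ j, x (κ ⟨i, j⟩) := fun i => if_pos rfl
      simp only [trinacria_proper_iff, hw, prod_mul_distrib, Fintype.prod_sigma]
      by_cases h : ∀ i i', i ≠ i' → κ ⟨i, 0⟩ ≠ κ ⟨i', 0⟩
      · by_cases h' : ∀ i, ∀ j : Fin (![a, b, c] i), κ ⟨i, j.castSucc⟩ ≠ κ ⟨i, j.succ⟩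
        · have h1 : (∏ i, ∏ j : Fin (![a, b, c] i),
              if κ ⟨i, j.castSucc⟩ ≠ κ ⟨i, j.succ⟩ then (1 : R) else 0) = 1 :=
            prod_eq_one fun i _ => prod_eq_one fun j _ => if_pos (h' i j)
          rw [if_pos ⟨h', h⟩, if_pos h, h1, one_mul]
        · rw [if_neg (fun h0 => h' h0.1), if_pos h]
          push Not at h'
          obtain ⟨i, j, hij⟩ := h'
          have h1 : (∏ i, ∏ j : Fin (![a, b, c] i),
              if κ ⟨i, j.castSucc⟩ ≠ κ ⟨i, j.succ⟩ then (1 : R) else 0) = 0 :=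
            prod_eq_zero (mem_univ i) (prod_eq_zero (mem_univ j) (if_neg (by simpa using hij)))
          rw [h1, zero_mul]
      · rw [if_neg (fun h0 => h h0.2), if_neg h]
    · intro s _ hs
      obtain ⟨i, hi⟩ := Function.ne_iff.1 hs
      rw [prod_eq_zero (mem_univ i), ite_self]
      exact if_neg fun h => hi h.symm
    · simp
  rw [h1, sum_comm]
  have h2 : ∀ s : Fin 3 → ι, ∑ κ : (i : Fin 3) → Fin (![a, b, c] i + 1) → ι,
      (if ∀ i i', i ≠ i' → s i ≠ s i' then
        ∏ i, (if κ i 0 = s i then pathWeight x (κ i) else 0) else 0) =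
      if s 0 ≠ s 1 ∧ s 0 ≠ s 2 ∧ s 1 ≠ s 2 then
        pathFrom x a (s 0) * (pathFrom x b (s 1) * pathFrom x c (s 2)) else 0 := by
    intro s
    have hs : (∀ i i', i ≠ i' → s i ≠ s i') ↔ s 0 ≠ s 1 ∧ s 0 ≠ s 2 ∧ s 1 ≠ s 2 := by
      simp only [Fin.forall_fin_succ, IsEmpty.forall_iff]
      simp [eq_comm]
      tauto
    simp only [hs]
    split_ifs with h
    · have := prod_univ_sum (fun i : Fin 3 => (univ : Finset (Fin (![a, b, c] i + 1) → ι)))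
        (fun i f => if f 0 = s i then pathWeight x f else 0)
      rw [Fintype.piFinset_univ] at this
      rw [← this]
      simp only [sum_pathWeight, Fin.prod_univ_three, mul_assoc]
      rfl
    · simp
  simp only [h2, trinacriaSum]
  rw [← (Fin.consEquiv fun _ : Fin 3 => ι).sum_comp, Fintype.sum_prod_type]
  refine sum_congr rfl fun i _ => ?_
  rw [← (Fin.consEquiv fun _ : Fin 2 => ι).sum_comp, Fintype.sum_prod_type]
  refine sum_congr rfl fun j _ => ?_
  rw [← (Equiv.funUnique (Fin 1) ι).symm.sum_comp]
  rfl

end Colourings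

/-! ### Reduction to finitely many variables -/

section Truncation

open scoped Classical in
/-- The part of a power series that only involves the variables of a finite set. -/
noncomputable def truncFun (s : Finset ℕ) (f : MvPowerSeries ℕ ℚ) : MvPowerSeries ℕ ℚ :=
  fun d => if d.support ⊆ s then MvPowerSeries.coeff d f else 0

theorem coeff_truncFun_of_subset {s : Finset ℕ} {d : ℕ →₀ ℕ} (h : d.support ⊆ s)
    (f : MvPowerSeries ℕ ℚ) :
    MvPowerSeries.coeff d (truncFun s f) = MvPowerSeries.coeff d f := if_pos h

theorem coeff_truncFun_of_not_subset {s : Finset ℕ} {d : ℕ →₀ ℕ} (h : ¬ d.support ⊆ s)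
    (f : MvPowerSeries ℕ ℚ) : MvPowerSeries.coeff d (truncFun s f) = 0 := if_neg h

/-- The ring homomorphism that kills the variables outside a finite set. -/
noncomputable def truncVars (s : Finset ℕ) : MvPowerSeries ℕ ℚ →+* MvPowerSeries ℕ ℚ where
  toFun := truncFun s
  map_zero' := by
    ext d
    by_cases h : d.support ⊆ s
    · rw [coeff_truncFun_of_subset h]
    · rw [coeff_truncFun_of_not_subset h, map_zero]
  map_one' := by
    classical
    ext d
    by_cases h : d.support ⊆ s
    · rw [coeff_truncFun_of_subset h]
    · rw [coeff_truncFun_of_not_subset h, MvPowerSeries.coeff_one, if_neg]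
      rintro rfl
      simp at h
  map_add' f g := by
    ext d
    by_cases h : d.support ⊆ s
    · simp only [coeff_truncFun_of_subset h, map_add]
    · simp only [coeff_truncFun_of_not_subset h, map_add, add_zero]
  map_mul' f g := by
    classical
    ext d
    rw [MvPowerSeries.coeff_mul]
    by_cases h : d.support ⊆ s
    · rw [coeff_truncFun_of_subset h, MvPowerSeries.coeff_mul]
      refine sum_congr rfl fun p hp => ?_
      rw [HasAntidiagonal.mem_antidiagonal] at hp
      rw [coeff_truncFun_of_subset, coeff_truncFun_of_subset]
      · exact fun i hi => h (by rw [← hp]; simp at hi ⊢; omega)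
      · exact fun i hi => h (by rw [← hp]; simp at hi ⊢; omega)
    · rw [coeff_truncFun_of_not_subset h]
      symm
      refine sum_eq_zero fun p hp => ?_
      rw [HasAntidiagonal.mem_antidiagonal] at hp
      by_cases h1 : p.1.support ⊆ s
      · rw [coeff_truncFun_of_not_subset (d := p.2), mul_zero]
        intro h2
        refine h fun i hi => ?_
        rw [← hp] at hi
        rcases mem_union.1 (Finsupp.support_add hi) with h3 | h3
        exacts [h1 h3, h2 h3]
      · rw [coeff_truncFun_of_not_subset h1, zero_mul]

theorem coeff_truncVars (s : Finset ℕ) (f : MvPowerSeries ℕ ℚ) (d : ℕ →₀ ℕ) :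
    MvPowerSeries.coeff d (truncVars s f) =
      if d.support ⊆ s then MvPowerSeries.coeff d f else 0 := by
  split_ifs with h
  exacts [coeff_truncFun_of_subset h f, coeff_truncFun_of_not_subset h f]

/-- The coefficient at `d` survives truncation to the support of `d`. -/
theorem eq_of_forall_truncVars_eq {f g : MvPowerSeries ℕ ℚ}
    (h : ∀ s, truncVars s f = truncVars s g) : f = g := by
  ext d
  have := congrArg (MvPowerSeries.coeff d) (h d.support)
  simpa [coeff_truncVars] using this

theorem prod_X_eq_monomial {V : Type*} (t : Finset V) (κ : V → ℕ) :
    ∏ v ∈ t, (MvPowerSeries.X (κ v) : MvPowerSeries ℕ ℚ) =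
      MvPowerSeries.monomial (∑ v ∈ t, Finsupp.single (κ v) 1) 1 := by
  classical
  induction t using Finset.induction_on with
  | empty => simp [MvPowerSeries.monomial_zero_eq_C_apply]
  | insert v t hv ih =>
    rw [prod_insert hv, sum_insert hv, ih, MvPowerSeries.X, MvPowerSeries.monomial_mul_monomial,
      one_mul]

theorem truncVars_elemSymm (s : Finset ℕ) (k : ℕ) :
    truncVars s (elemSymm k) =
      elemSum (fun c : s => (MvPowerSeries.X (c : ℕ) : MvPowerSeries ℕ ℚ)) k := by
  classical
  have apply_sum : ∀ (t : Finset s) (i : ℕ),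
      (∑ c ∈ t, Finsupp.single (c : ℕ) 1 : ℕ →₀ ℕ) i = if i ∈ t.map (Function.Embedding.subtype _)
        then 1 else 0 := by
    intro t i
    have h : (∑ c ∈ t, Finsupp.single (c : ℕ) 1 : ℕ →₀ ℕ) =
        ∑ c ∈ t.map (Function.Embedding.subtype (· ∈ s)), Finsupp.single c 1 := by
      rw [sum_map]
      rfl
    rw [h, Finsupp.finsetSum_apply]
    simp [Finsupp.single_apply]
  ext d
  simp only [elemSum, prod_X_eq_monomial, map_sum, MvPowerSeries.coeff_monomial]
  rw [coeff_truncVars, MvPowerSeries.coeff_apply, elemSymm]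
  by_cases h : ∃ t ∈ powersetCard k (univ : Finset s), d = ∑ c ∈ t, Finsupp.single (c : ℕ) 1
  · obtain ⟨t, ht, rfl⟩ := h
    rw [sum_eq_single t, if_pos, if_pos, if_pos rfl]
    · refine ⟨fun i => ?_, ?_⟩
      · rw [apply_sum]
        split_ifs <;> simp
      · rw [map_sum]
        simp [(mem_powersetCard.1 ht).2]
    · intro i hi
      rw [Finsupp.mem_support_iff, apply_sum] at hi
      have : i ∈ t.map (Function.Embedding.subtype _) := by
        by_contra h0
        exact hi (if_neg h0)
      obtain ⟨c, _, rfl⟩ := mem_map.1 this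
      exact c.2
    · intro t' _ hne
      refine if_neg fun heq => hne ?_
      refine map_injective (Function.Embedding.subtype (· ∈ s)) (Finset.ext fun i => ?_)
      have := DFunLike.congr_fun heq i
      rw [apply_sum, apply_sum] at this
      by_cases h1 : i ∈ t.map (Function.Embedding.subtype (· ∈ s)) <;>
        by_cases h2 : i ∈ t'.map (Function.Embedding.subtype (· ∈ s)) <;> simp [h1, h2] at this ⊢
    · exact fun h => absurd ht h
  · rw [sum_eq_zero fun t ht => if_neg fun h0 => h ⟨t, ht, h0⟩]
    split_ifs with h1 h2
    · exfalso
      -- The exponents are 0 or 1, so `d` is the indicator of the set where it equals 1.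
      have hd : d = ∑ c ∈ univ.filter (fun c : s => d c = 1), Finsupp.single (c : ℕ) 1 := by
        ext i
        rw [apply_sum]
        have := h2.1 i
        by_cases hi : d i = 0
        · rw [hi, if_neg]
          simp [hi]
        · have h3 : d i = 1 := by omega
          rw [h3, if_pos]
          simp only [mem_map, mem_filter, mem_univ, true_and, Function.Embedding.coe_subtype]
          exact ⟨⟨i, h1 (Finsupp.mem_support_iff.2 hi)⟩, h3, rfl⟩
      refine h ⟨_, mem_powersetCard.2 ⟨subset_univ _, ?_⟩, hd⟩
      have := h2.2
      rw [hd, map_sum] at this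
      simpa using this
    · rfl
    · rfl

theorem truncVars_chromaticSymm {V : Type*} [Fintype V] [DecidableEq V] (G : SimpleGraph V)
    (s : Finset ℕ) :
    truncVars s G.chromaticSymm =
      colouringSum (fun c : s => (MvPowerSeries.X (c : ℕ) : MvPowerSeries ℕ ℚ)) G := by
  classical
  have content : ∀ κ : V → s,
      ∑ v, Finsupp.single (κ v : ℕ) 1 = SimpleGraph.colorContent fun v => (κ v : ℕ) := fun κ => rfl
  have mem_support : ∀ (κ : V → ℕ) v, κ v ∈ (SimpleGraph.colorContent κ).support := by
    intro κ v
    simp only [Finsupp.mem_support_iff, SimpleGraph.colorContent, Finsupp.finsetSum_apply]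
    intro h
    have := (Finset.sum_eq_zero_iff.mp h) v (Finset.mem_univ v)
    simp at this
  ext d
  have h1 : MvPowerSeries.coeff d
      (colouringSum (fun c : s => (MvPowerSeries.X (c : ℕ) : MvPowerSeries ℕ ℚ)) G) =
      Nat.card {κ : V → s // (∀ u v, G.Adj u v → κ u ≠ κ v) ∧
        SimpleGraph.colorContent (fun v => (κ v : ℕ)) = d} := by
    rw [colouringSum, map_sum, Nat.card_eq_fintype_card, Fintype.card_subtype, card_filter,
      Nat.cast_sum]
    refine sum_congr rfl fun κ _ => ?_
    split_ifs with h2 h3 h3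
    · rw [prod_X_eq_monomial, MvPowerSeries.coeff_monomial, content, if_pos h3.2.symm, Nat.cast_one]
    · rw [prod_X_eq_monomial, MvPowerSeries.coeff_monomial, content,
        if_neg fun h => h3 ⟨h2, h.symm⟩, Nat.cast_zero]
    · exact absurd h3.1 h2
    · simp
  rw [h1, coeff_truncVars]
  split_ifs with hd
  · rw [MvPowerSeries.coeff_apply, SimpleGraph.chromaticSymm, Nat.cast_inj]
    refine Nat.card_congr ⟨fun κ => ⟨fun v => ⟨κ.1 v, hd ?_⟩, ?_, ?_⟩,
      fun κ => ⟨SimpleGraph.Coloring.mk (fun v => (κ.1 v : ℕ)) ?_, ?_⟩, ?_, ?_⟩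
    · have := mem_support κ.1 v
      rwa [κ.2] at this
    · exact fun u v h h' => κ.1.valid h (congrArg Subtype.val h')
    · exact κ.2
    · exact fun {u v} h h' => κ.2.1 u v h (Subtype.ext h')
    · exact κ.2.2
    · exact fun κ => rfl
    · exact fun κ => rfl
  · rw [eq_comm, Nat.cast_eq_zero, Nat.card_eq_zero]
    left
    constructor
    rintro ⟨κ, _, rfl⟩
    refine hd fun i hi => ?_
    rw [SimpleGraph.colorContent] at hi
    obtain ⟨v, _, hv⟩ := mem_biUnion.1 (Finsupp.support_finsetSum hi)
    have := Finsupp.support_single_subset hv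
    rw [mem_singleton] at this
    rw [this]
    exact (κ v).2

end Truncation

section RingHom

variable {R S : Type*} [CommRing R] [Algebra ℚ R] [CommRing S] [Algebra ℚ S] (f : R →+* S)
  (e : ℕ → R)

theorem map_wordSum (n : ℕ) (φ : List ℕ → ℚ) :
    f (wordSum e n φ) = wordSum (fun k => f (e k)) n φ := by
  simp only [wordSum, map_sum, map_rat_smul, wordWeight, map_list_prod, List.map_map,
    Function.comp_def]

theorem map_noOnesPart (b : ℕ) : f (noOnesPart e b) = noOnesPart (fun k => f (e k)) b := by
  simp [noOnesPart, headSum, map_wordSum, map_ofNat]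

theorem map_oneOnePart (b : ℕ) : f (oneOnePart e b) = oneOnePart (fun k => f (e k)) b := by
  simp [oneOnePart, headSum, weightSum, map_wordSum, map_ofNat]

theorem map_twoOnesPart (b : ℕ) : f (twoOnesPart e b) = twoOnesPart (fun k => f (e k)) b := by
  simp [twoOnesPart, weightSum, map_wordSum, map_ofNat]

end RingHom

theorem chromaticSymm_trinacria (b : ℕ) :
    (SimpleGraph.trinacria (b + 2) b 2).chromaticSymm =
      noOnesPart elemSymm b + elemSymm 1 * oneOnePart elemSymm b +
        elemSymm 1 * (elemSymm 1 * twoOnesPart elemSymm b) := by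
  refine eq_of_forall_truncVars_eq fun s => ?_
  rw [truncVars_chromaticSymm, colouringSum_trinacria, trinacriaSum_expansion]
  simp only [map_add, map_mul, map_noOnesPart, map_oneOnePart, map_twoOnesPart, truncVars_elemSymm]

/-! ### From word positivity to e-positivity -/

section EPositive

theorem isEPositive_zero : IsEPositive 0 := ⟨0, by simp, by simp⟩

theorem IsEPositive.add {f g : MvPowerSeries ℕ ℚ} (hf : IsEPositive f) (hg : IsEPositive g) :
    IsEPositive (f + g) := by
  classical
  obtain ⟨c, hc, rfl⟩ := hf
  obtain ⟨c', hc', rfl⟩ := hg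
  refine ⟨c + c', fun μ => add_nonneg (hc μ) (hc' μ), ?_⟩
  rw [Finsupp.sum_add_index'] <;> simp [add_smul]

theorem IsEPositive.sum {ι : Type*} {s : Finset ι} {f : ι → MvPowerSeries ℕ ℚ}
    (h : ∀ i ∈ s, IsEPositive (f i)) : IsEPositive (∑ i ∈ s, f i) :=
  Finset.sum_induction f IsEPositive (fun _ _ => IsEPositive.add) isEPositive_zero h

theorem isEPositive_smul_prod {a : ℚ} (ha : 0 ≤ a) {K : List ℕ} (hK : ∀ i ∈ K, 0 < i) :
    IsEPositive (a • (K.map elemSymm).prod) := by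
  refine ⟨Finsupp.single ⟨K.sum, ⟨K, fun {i} hi => hK i (by simpa using hi), by simp⟩⟩ a,
    fun μ => ?_, ?_⟩
  · classical
    rw [Finsupp.single_apply]
    split_ifs
    exacts [ha, le_rfl]
  · rw [Finsupp.sum_single_index (by simp)]
    simp [elemSymmPart]

/-- The weight of a word is an e-product times the positive number ∏ (i - 1). The list `I` carries
the power of e_1. -/
theorem IsWordPositive.isEPositive {n : ℕ} {f : MvPowerSeries ℕ ℚ}
    (hf : IsWordPositive elemSymm n f) {I : List ℕ} (hI : ∀ i ∈ I, 0 < i) :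
    IsEPositive ((I.map elemSymm).prod * f) := by
  obtain ⟨φ, hφ, rfl⟩ := hf
  rw [wordSum, mul_sum]
  refine IsEPositive.sum fun K hK => ?_
  have h2 := (mem_blockWords.1 hK).1
  have hw : wordWeight elemSymm K =
      (K.map fun i : ℕ => (i : ℚ) - 1).prod • (K.map elemSymm).prod := by
    clear hK hφ
    induction K with
    | nil => simp [wordWeight]
    | cons i K ih =>
      have := ih fun j hj => h2 j (by simp [hj])
      simp only [wordWeight, List.map_cons, List.prod_cons] at this ⊢
      rw [this, smul_mul_smul_comm]
  rw [hw, smul_smul, mul_smul_comm, ← List.prod_append, ← List.map_append]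
  refine isEPositive_smul_prod (mul_nonneg (hφ K hK) (List.prod_nonneg fun a ha => ?_))
    fun i hi => ?_
  · obtain ⟨i, hi, rfl⟩ := List.mem_map.1 ha
    have : (2 : ℚ) ≤ i := by exact_mod_cast h2 i hi
    linarith
  · rcases List.mem_append.1 hi with h | h
    · exact hI i h
    · have := h2 i h
      omega

end EPositive

theorem theorem1p1 (b : ℕ) :
    IsEPositive (SimpleGraph.trinacria (b + 2) b 2).chromaticSymm := by
  rw [chromaticSymm_trinacria]
  have h0 := (isWordPositive_no_ones elemSymm b).isEPositive (I := []) (by simp)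
  have h1 := (isWordPositive_one_one elemSymm b).isEPositive (I := [1]) (by simp)
  have h2 := (isWordPositive_two_ones elemSymm b).isEPositive (I := [1, 1]) (by simp)
  simp only [List.map_cons, List.map_nil, List.prod_cons, List.prod_nil, one_mul, mul_one,
    mul_assoc] at h0 h1 h2
  exact (h0.add h1).add h2
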